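/- Let $k\ge 1$ be an integer, let $\lambda_1,\dots,\lambda_k>0$, put $\Lambda=\lambda_1+\dots+\lambda_k$, and let $\nu\in(0,1]$. For $\nu=1$ let $\frac{d^\nu f}{dt^\nu}=f'$ and for $0<\nu<1$ let $$\frac{d^\nu f}{dt^\nu}(t)=\frac1{\Gamma(1-\nu)}\int_0^t\frac{f'(s)}{(t-s)^\nu}\,ds$$ be the Caputo derivative (for $f$ absolutely continuous on $[0,t]$ and the integral absolutely convergent). Let $$E^{\gamma}_{\alpha,\beta}(z)=\sum_{n=0}^\infty\frac{(\gamma)_n\,z^n}{n!\,\Gamma(\alpha n+\beta)},\qquad (\gamma)_0=1,\quad (\gamma)_n=\gamma(\gamma+1)\cdots(\gamma+n-1).$$ Consider the Cauchy problem for functions $p_j:[0,\infty)\to\mathbb R$, $j=0,1,2,\dots$, continuous on $[0,\infty)$, with, for all $t>0$, $$\frac{d^\nu p_0}{dt^\nu}=-\Lambda p_0,\qquad \frac{d^\nu p_j}{dt^\nu}=\sum_{r=1}^{\min(j,k)}\lambda_r\,p_{j-r}-\Lambda p_j\quad(j\ge1),$$ and $p_0(0)=1$, $p_j(0)=0$ for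 $j\ge1$. This problem has exactly one solution, and it is given, for all $j\ge 0$ and $t\ge0$, by $$p_j^\nu(t)=\sum_{r=0}^{j}\ \sum_{\substack{\alpha_1+\dots+\alpha_k=r\\ \alpha_1+2\alpha_2+\dots+k\alpha_k=j}}\binom{r}{\alpha_1,\dots,\alpha_k}\lambda_1^{\alpha_1}\cdots\lambda_k^{\alpha_k}\;t^{r\nu}\,E^{r+1}_{\nu,r\nu+1}(-\Lambda t^\nu),$$ where the inner sum is over $(\alpha_1,\dots,\alpha_k)\in\{0,1,2,\dots\}^k$, $t^{0}=1$ also at $t=0$, and the series defining the values of $E$ converge absolutely. Moreover, each $p_j^\nu$ is differentiable on $(0,\infty)$. -/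

import Mathlib

noncomputable section

/-- The generalized (three-parameter) Mittag-Leffler function
`E^γ_{α,β}(z) = ∑_{r ≥ 0} (γ)_r z^r / (r! Γ(α r + β))`, for real parameters, where `(γ)_r` is the
rising factorial. -/
def genMittagLeffler (α β γ z : ℝ) : ℝ :=
  ∑' r : ℕ, (ascPochhammer ℝ r).eval γ * z ^ r / ((r.factorial : ℝ) * Real.Gamma (α * r + β))

/-- `f` has at `t > 0` the Caputo derivative `v` of order `ν ∈ (0, 1]` (with base point `0`).
For `ν = 1` this is the ordinary derivative. For `0 < ν < 1` it means that `f` is absolutely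
continuous on `[0, t]`, that the integral `∫_0^t f'(s) (t - s)^(-ν) ds` converges absolutely, and
that, divided by `Γ(1 - ν)`, it equals `v`. -/
def HasCaputoDerivAt (ν : ℝ) (f : ℝ → ℝ) (v t : ℝ) : Prop :=
  (ν = 1 ∧ HasDerivAt f v t) ∨
  (0 < ν ∧ ν < 1 ∧ AbsolutelyContinuousOnInterval f 0 t ∧
    IntervalIntegrable (fun s => deriv f s / (t - s) ^ ν) MeasureTheory.volume 0 t ∧
    1 / Real.Gamma (1 - ν) * ∫ s in (0 : ℝ)..t, deriv f s / (t - s) ^ ν = v)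

/-- The total rate `Λ = λ_1 + ⋯ + λ_k`. -/
def totalRate (k : ℕ) (lam : ℕ → ℝ) : ℝ := ∑ r ∈ Finset.Icc 1 k, lam r

/-- `p = (p_j)_{j ≥ 0}` solves the Cauchy problem for the fractional difference-differential
equations with jump sizes `1, …, k` and rates `λ_1, …, λ_k`. The functions `p_j` are continuous on
`[0, ∞)` and the equations hold at every `t > 0`. -/
structure IsCauchySolution (k : ℕ) (lam : ℕ → ℝ) (ν : ℝ) (p : ℕ → ℝ → ℝ) : Prop where
  continuousOn : ∀ j, ContinuousOn (p j) (Set.Ici 0)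
  eq_zero : ∀ t, 0 < t → HasCaputoDerivAt ν (p 0) (-totalRate k lam * p 0 t) t
  eq_low : ∀ j, 1 ≤ j → j < k → ∀ t, 0 < t → HasCaputoDerivAt ν (p j)
    (∑ r ∈ Finset.Icc 1 j, lam r * p (j - r) t - totalRate k lam * p j t) t
  eq_high : ∀ j, k ≤ j → ∀ t, 0 < t → HasCaputoDerivAt ν (p j)
    (∑ r ∈ Finset.Icc 1 k, lam r * p (j - r) t - totalRate k lam * p j t) t
  init_zero : p 0 0 = 1
  init_pos : ∀ j, 1 ≤ j → p j 0 = 0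

/-- The multi-indices `(α_1, …, α_k)` of natural numbers with `α_1 + ⋯ + α_k = r` and
`α_1 + 2 α_2 + ⋯ + k α_k = j`, as functions on `ℕ` that vanish outside `{1, …, k}`. -/
def jumpIndices (k r j : ℕ) : Finset (ℕ → ℕ) :=
  (Finset.piAntidiag (Finset.Icc 1 k) r).filter
    (fun α => ∑ i ∈ Finset.Icc 1 k, i * α i = j)

/-- The explicit formula for `p_j^ν(t)`. -/
def fracPmf (k : ℕ) (lam : ℕ → ℝ) (ν : ℝ) (j : ℕ) (t : ℝ) : ℝ :=
  ∑ r ∈ Finset.range (j + 1), ∑ α ∈ jumpIndices k r j,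
    (Nat.multinomial (Finset.Icc 1 k) α : ℝ) * (∏ i ∈ Finset.Icc 1 k, lam i ^ α i) *
      t ^ ((r : ℝ) * ν) *
      genMittagLeffler ν ((r : ℝ) * ν + 1) ((r : ℝ) + 1) (-totalRate k lam * t ^ ν)

end

/-!
Everything is reduced to fractional power series `S_a(t) = ∑ m, a_m t^(ν m) / Γ(ν m + 1)` with
geometrically bounded coefficients (`fracSeries`). They are entire in `t^ν`, because `Γ(s + 1)`
dominates every `c^s` (`rpow_mul_exp_neg_le_Gamma_add_one`).

*Existence.* The Caputo derivative of order `ν` sends `t^(ν m) / Γ(ν m + 1)` to the same expression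
with `m - 1`, by the Beta integral, so it acts on `S_a` by shifting the coefficients
(`hasCaputoDerivAt_fracSeries`). By the multinomial theorem the inner sums in `fracPmf` are the
coefficients of `x^j` in the powers of `λ_1 x + ⋯ + λ_k x^k` (`sum_jumpIndices`), and
`(r + 1)_n / n!` is the binomial coefficient `binom(n + r, r)`. Hence `fracPmf k lam ν j` is `S_a`
with `a_m = ∑ r, [x^j] (λ_1 x + ⋯ + λ_k x^k)^r binom(m, r) (-Λ)^(m - r)`. For these coefficients,
Pascal's rule together with one multiplication by `λ_1 x + ⋯ + λ_k x^k` is precisely the system of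
equations (`pmfCoeff_succ`).

*Uniqueness.* Abel's inversion (`integral_sub_rpow_mul_integral`) turns each equation into a Volterra
integral equation with kernel `(t - s)^(ν - 1) / Γ(ν)`. By induction on `j`, the difference `u` of two
solutions satisfies `u(t) = -Λ / Γ(ν) ∫_0^t (t - s)^(ν - 1) u(s) ds`, and the integral operator is a
strict contraction in the norm `sup |u(s)| e^(-c s)` for large `c`, so `u = 0`
(`eq_zero_of_eq_fractional_integral`).
-/

noncomputable section

open MeasureTheory Set Filter Topology

/-! ### Beta integrals and the growth of the Gamma function -/

theorem integral_rpow_mul_sub_rpow {a b t : ℝ} (ha : 0 < a) (hb : 0 < b) (ht : 0 < t) :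
    ∫ s in (0 : ℝ)..t, s ^ (a - 1) * (t - s) ^ (b - 1) =
      t ^ (a + b - 1) * (Real.Gamma a * Real.Gamma b / Real.Gamma (a + b)) := by
  have h := Complex.betaIntegral_scaled a b ht
  rw [Complex.betaIntegral_eq_Gamma_mul_div _ _ (by simpa) (by simpa)] at h
  have hcast : ∫ s in (0 : ℝ)..t, (s : ℂ) ^ ((a : ℂ) - 1) * ((t : ℂ) - s) ^ ((b : ℂ) - 1) =
      ((∫ s in (0 : ℝ)..t, s ^ (a - 1) * (t - s) ^ (b - 1) : ℝ) : ℂ) := by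
    rw [← intervalIntegral.integral_ofReal]
    refine intervalIntegral.integral_congr fun s hs => ?_
    rw [uIcc_of_le ht.le] at hs
    simp only [Complex.ofReal_mul, Complex.ofReal_cpow hs.1,
      Complex.ofReal_cpow (sub_nonneg.2 hs.2), Complex.ofReal_sub, Complex.ofReal_one]
  rw [hcast] at h
  rw [← Complex.ofReal_inj, h]
  simp only [Complex.ofReal_mul, Complex.ofReal_cpow ht.le, Complex.ofReal_sub, Complex.ofReal_one,
    Complex.ofReal_add, Complex.ofReal_div, ← Complex.Gamma_ofReal]

theorem intervalIntegrable_rpow_mul_sub_rpow {a b t : ℝ} (ha : 0 < a) (hb : 0 < b) (ht : 0 < t) :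
    IntervalIntegrable (fun s : ℝ => s ^ (a - 1) * (t - s) ^ (b - 1)) volume 0 t := by
  -- A nonzero Bochner integral forces integrability.
  refine intervalIntegral.intervalIntegrable_of_integral_ne_zero ?_
  rw [integral_rpow_mul_sub_rpow ha hb ht]
  have := Real.Gamma_pos_of_pos ha
  have := Real.Gamma_pos_of_pos hb
  have := Real.Gamma_pos_of_pos (add_pos ha hb)
  positivity

/-- Restricting the Gamma integral to `(c, ∞)` shows that `Γ` grows faster than any exponential. -/
theorem rpow_mul_exp_neg_le_Gamma_add_one {c s : ℝ} (hc : 0 < c) (hs : 0 ≤ s) :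
    c ^ s * Real.exp (-c) ≤ Real.Gamma (s + 1) := by
  have hint := Real.GammaIntegral_convergent (s := s + 1) (by linarith)
  rw [Real.Gamma_eq_integral (by linarith)]
  simp only [add_sub_cancel_right] at hint ⊢
  calc c ^ s * Real.exp (-c) = ∫ x in Ioi c, c ^ s * Real.exp (-x) := by
        rw [integral_const_mul, integral_exp_neg_Ioi]
    _ ≤ ∫ x in Ioi c, Real.exp (-x) * x ^ s := by
        refine setIntegral_mono_on ?_ (hint.mono_set (Ioi_subset_Ioi hc.le)) measurableSet_Ioi ?_
        · exact (integrableOn_exp_neg_Ioi c).const_mul _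
        · intro x hx
          rw [mul_comm]
          exact mul_le_mul_of_nonneg_left (Real.rpow_le_rpow hc.le (le_of_lt hx) hs)
            (Real.exp_pos _).le
    _ ≤ ∫ x in Ioi 0, Real.exp (-x) * x ^ s := by
        refine setIntegral_mono_set hint ?_ (Ioi_subset_Ioi hc.le).eventuallyLE
        filter_upwards [ae_restrict_mem measurableSet_Ioi] with x hx
        have : (0 : ℝ) < x := hx
        positivity

theorem summable_pow_div_Gamma {ν : ℝ} (hν : 0 < ν) (x : ℝ) :
    Summable fun m : ℕ => |x| ^ m / Real.Gamma (ν * m + 1) := by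
  -- This `c` makes the terms at most `e^c 2^(-m)`.
  obtain ⟨c, hc, hcν⟩ : ∃ c : ℝ, 0 < c ∧ c ^ ν = 2 * (|x| + 1) :=
    ⟨(2 * (|x| + 1)) ^ ν⁻¹, by positivity, Real.rpow_inv_rpow (by positivity) hν.ne'⟩
  refine Summable.of_nonneg_of_le (fun m => ?_) (fun m => ?_)
    ((summable_geometric_of_lt_one (r := (1 / 2 : ℝ)) (by norm_num) (by norm_num)).mul_left
      (Real.exp c))
  · have := Real.Gamma_pos_of_pos (show 0 < ν * m + 1 by positivity)
    positivity
  · have hG := rpow_mul_exp_neg_le_Gamma_add_one hc (show 0 ≤ ν * m by positivity)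
    have hpos := Real.Gamma_pos_of_pos (show 0 < ν * m + 1 by positivity)
    rw [Real.rpow_mul hc.le, hcν, Real.rpow_natCast] at hG
    rw [div_le_iff₀ hpos]
    calc |x| ^ m ≤ (|x| + 1) ^ m := by gcongr; linarith
      _ = Real.exp c * (1 / 2) ^ m * ((2 * (|x| + 1)) ^ m * Real.exp (-c)) := by
          rw [mul_pow, Real.exp_neg]
          field_simp
          rw [← mul_pow]; norm_num
      _ ≤ _ := by gcongr

/-! ### Power series with Gamma denominators -/

section

/-- A real sequence of at most geometric growth: `|a_m| ≤ C K^m` for some nonnegative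
`C` and `K`. -/
def GeomBounded (a : ℕ → ℝ) : Prop := ∃ C K : ℝ, 0 ≤ C ∧ 0 ≤ K ∧ ∀ m, |a m| ≤ C * K ^ m

/-- The entire function `∑ m, a_m z^m / Γ(ν m + 1)`. -/
def gammaSeries (ν : ℝ) (a : ℕ → ℝ) (z : ℝ) : ℝ :=
  ∑' m : ℕ, a m * z ^ m / Real.Gamma (ν * m + 1)

/-- The function `∑ n, a_{n+1} z^n / Γ(ν (n + 1))`, which is `ν` times the derivative of
`gammaSeries ν a`. -/
def gammaSeriesDeriv (ν : ℝ) (a : ℕ → ℝ) (z : ℝ) : ℝ :=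
  ∑' n : ℕ, a (n + 1) * z ^ n / Real.Gamma (ν * (n + 1))

/-- The fractional power series `∑ m, a_m t^(ν m) / Γ(ν m + 1)`. -/
def fracSeries (ν : ℝ) (a : ℕ → ℝ) (t : ℝ) : ℝ := gammaSeries ν a (t ^ ν)

theorem GeomBounded.shift {a : ℕ → ℝ} (ha : GeomBounded a) : GeomBounded fun m => a (m + 1) := by
  obtain ⟨C, K, hC, hK, h⟩ := ha
  exact ⟨C * K, K, by positivity, hK, fun m => (h (m + 1)).trans_eq (by ring)⟩

variable {ν : ℝ} {a : ℕ → ℝ}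

theorem GeomBounded.summable_abs (ha : GeomBounded a) (hν : 0 < ν) (z : ℝ) :
    Summable fun m : ℕ => |a m| * |z| ^ m / Real.Gamma (ν * m + 1) := by
  obtain ⟨C, K, hC, hK, h⟩ := ha
  have hG : ∀ m : ℕ, 0 < Real.Gamma (ν * m + 1) := fun m =>
    Real.Gamma_pos_of_pos (by positivity)
  refine Summable.of_nonneg_of_le (fun m => ?_) (fun m => ?_)
    ((summable_pow_div_Gamma hν (K * z)).mul_left C)
  · have := hG m
    positivity
  · rw [abs_mul, abs_of_nonneg hK, mul_pow, ← mul_div_assoc, ← mul_assoc]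
    have := hG m
    have := h m
    gcongr

theorem GeomBounded.summable (ha : GeomBounded a) (hν : 0 < ν) (z : ℝ) :
    Summable fun m : ℕ => a m * z ^ m / Real.Gamma (ν * m + 1) := by
  refine Summable.of_norm_bounded (ha.summable_abs hν z) fun m => ?_
  have := Real.Gamma_pos_of_pos (show 0 < ν * m + 1 by positivity)
  rw [Real.norm_eq_abs, abs_div, abs_mul, abs_pow, abs_of_pos this]

theorem Gamma_mul_succ_add_one (hν : 0 < ν) (n : ℕ) :
    Real.Gamma (ν * (n + 1) + 1) = ν * (n + 1) * Real.Gamma (ν * (n + 1)) :=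
  Real.Gamma_add_one (by positivity)

theorem GeomBounded.nat_mul (ha : GeomBounded a) : GeomBounded fun m => m * a m := by
  obtain ⟨C, K, hC, hK, h⟩ := ha
  refine ⟨C, 2 * K, hC, by positivity, fun m => ?_⟩
  rw [abs_mul, Nat.abs_cast, mul_pow, mul_left_comm]
  have h2 : (m : ℝ) ≤ 2 ^ m := by exact_mod_cast Nat.lt_two_pow_self.le
  exact mul_le_mul h2 (h m) (abs_nonneg _) (by positivity)

/-- Absolute convergence of the series `gammaSeriesDeriv`, by comparison with the coefficients
`m a_m`, since `Γ(ν (n + 1) + 1) = ν (n + 1) Γ(ν (n + 1))`. -/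
theorem GeomBounded.summable_deriv_abs (ha : GeomBounded a) (hν : 0 < ν) (z : ℝ) :
    Summable fun n : ℕ => |a (n + 1)| * |z| ^ n / Real.Gamma (ν * (n + 1)) := by
  obtain ⟨R, hR, hz⟩ : ∃ R : ℝ, 1 ≤ R ∧ |z| ≤ R := ⟨max 1 |z|, le_max_left _ _, le_max_right _ _⟩
  have hs := (((summable_nat_add_iff 1).2 (ha.nat_mul.summable_abs hν R)).mul_left ν)
  refine Summable.of_nonneg_of_le (fun n => ?_) (fun n => ?_) hs
  · have := Real.Gamma_pos_of_pos (show 0 < ν * (n + 1) by positivity)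
    positivity
  · have := Real.Gamma_pos_of_pos (show 0 < ν * (n + 1) by positivity)
    push_cast
    rw [Gamma_mul_succ_add_one hν, abs_mul, abs_of_nonneg (show (0 : ℝ) ≤ n + 1 by positivity),
      abs_of_nonneg (zero_le_one.trans hR)]
    calc |a (n + 1)| * |z| ^ n / Real.Gamma (ν * (n + 1))
        ≤ |a (n + 1)| * R ^ (n + 1) / Real.Gamma (ν * (n + 1)) := by
          gcongr
          exact (pow_le_pow_left₀ (abs_nonneg _) hz n).trans (pow_le_pow_right₀ hR n.le_succ)
      _ = _ := by field_simp

theorem GeomBounded.summable_deriv (ha : GeomBounded a) (hν : 0 < ν) (z : ℝ) :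
    Summable fun n : ℕ => a (n + 1) * z ^ n / Real.Gamma (ν * (n + 1)) := by
  refine Summable.of_norm_bounded (ha.summable_deriv_abs hν z) fun n => ?_
  have := Real.Gamma_pos_of_pos (show 0 < ν * (n + 1) by positivity)
  rw [Real.norm_eq_abs, abs_div, abs_mul, abs_pow, abs_of_pos this]

theorem hasDerivAt_gammaSeries (ha : GeomBounded a) (hν : 0 < ν) (z : ℝ) :
    HasDerivAt (gammaSeries ν a) (ν⁻¹ * gammaSeriesDeriv ν a z) z := by
  have hterm : ∀ m : ℕ, ∀ y : ℝ, HasDerivAt (fun y => a m * y ^ m / Real.Gamma (ν * m + 1))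
      (a m * (m * y ^ (m - 1)) / Real.Gamma (ν * m + 1)) y := fun m y =>
    ((hasDerivAt_pow m y).const_mul _).div_const _
  have hshift : ∀ (n : ℕ) (y : ℝ), a (n + 1) * ((n + 1 : ℕ) * y ^ n) /
      Real.Gamma (ν * (n + 1 : ℕ) + 1) =
      ν⁻¹ * (a (n + 1) * y ^ n / Real.Gamma (ν * (n + 1))) := fun n y => by
    have := Real.Gamma_pos_of_pos (show 0 < ν * (n + 1) by positivity)
    push_cast
    rw [Gamma_mul_succ_add_one hν]
    field_simp
  have hval : ∀ y : ℝ, ∑' m : ℕ, a m * (m * y ^ (m - 1)) / Real.Gamma (ν * m + 1) =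
      ν⁻¹ * gammaSeriesDeriv ν a y := fun y => by
    have hs : Summable fun m : ℕ => a m * (m * y ^ (m - 1)) / Real.Gamma (ν * m + 1) := by
      rw [← summable_nat_add_iff 1]
      simp only [Nat.add_sub_cancel, hshift]
      exact (ha.summable_deriv hν y).mul_left ν⁻¹
    rw [hs.tsum_eq_zero_add]
    simp only [Nat.add_sub_cancel, hshift, tsum_mul_left, gammaSeriesDeriv]
    simp
  rw [← hval]
  set R := |z| + 1 with hR
  have hbound : Summable fun m : ℕ => |a m| * (m * R ^ (m - 1)) / Real.Gamma (ν * m + 1) := by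
    rw [← summable_nat_add_iff 1]
    refine ((ha.summable_deriv_abs hν R).mul_left ν⁻¹).congr fun n => ?_
    have := Real.Gamma_pos_of_pos (show 0 < ν * (n + 1) by positivity)
    have hR0 : |R| = R := abs_of_pos (by positivity)
    push_cast
    rw [Gamma_mul_succ_add_one hν, hR0]
    field_simp
  refine hasDerivAt_tsum_of_isPreconnected hbound Metric.isOpen_ball
    (convex_ball (0 : ℝ) R).isPreconnected (fun m y _ => hterm m y) (fun m y hy => ?_)
    (Metric.mem_ball_self (by positivity)) (ha.summable hν 0) (by simp [hR])
  have hy' : |y| ≤ R := by simpa using (Metric.mem_ball.1 hy).le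
  have := Real.Gamma_pos_of_pos (show 0 < ν * m + 1 by positivity)
  rw [Real.norm_eq_abs, abs_div, abs_mul, abs_mul, abs_pow, abs_of_pos this, Nat.abs_cast]
  gcongr

theorem continuous_gammaSeries (ha : GeomBounded a) (hν : 0 < ν) : Continuous (gammaSeries ν a) :=
  continuous_iff_continuousAt.2 fun z => (hasDerivAt_gammaSeries ha hν z).continuousAt

theorem continuous_fracSeries (ha : GeomBounded a) (hν : 0 < ν) :
    Continuous (fracSeries ν a) :=
  (continuous_gammaSeries ha hν).comp (Real.continuous_rpow_const hν.le)

theorem hasDerivAt_fracSeries (ha : GeomBounded a) (hν : 0 < ν) {t : ℝ} (ht : 0 < t) :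
    HasDerivAt (fracSeries ν a) (t ^ (ν - 1) * gammaSeriesDeriv ν a (t ^ ν)) t := by
  refine ((hasDerivAt_gammaSeries ha hν (t ^ ν)).comp t
    (Real.hasDerivAt_rpow_const (Or.inl ht.ne'))).congr_deriv ?_
  field_simp

theorem hasSum_deriv_fracSeries (ha : GeomBounded a) (hν : 0 < ν) {t : ℝ} (ht : 0 < t) :
    HasSum (fun n : ℕ => a (n + 1) / Real.Gamma (ν * (n + 1)) * t ^ (ν * (n + 1) - 1))
      (deriv (fracSeries ν a) t) := by
  rw [(hasDerivAt_fracSeries ha hν ht).deriv]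
  convert! (ha.summable_deriv hν (t ^ ν)).hasSum.mul_left (t ^ (ν - 1)) using 2 with n
  rw [← Real.rpow_natCast, ← Real.rpow_mul ht.le,
    show ν * ((n : ℝ) + 1) - 1 = (ν - 1) + ν * n by ring, Real.rpow_add ht]
  ring

/-- The derivative has at most the integrable singularity `t^(ν - 1)` at `0`. -/
theorem exists_abs_deriv_fracSeries_le (ha : GeomBounded a) (hν : 0 < ν) (T : ℝ) :
    ∃ B : ℝ, ∀ t, 0 < t → t ≤ T → |deriv (fracSeries ν a) t| ≤ B * t ^ (ν - 1) := by
  refine ⟨∑' n : ℕ, |a (n + 1)| * |T ^ ν| ^ n / Real.Gamma (ν * (n + 1)), fun t ht htT => ?_⟩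
  rw [(hasDerivAt_fracSeries ha hν ht).deriv, abs_mul, mul_comm,
    abs_of_pos (Real.rpow_pos_of_pos ht _)]
  refine mul_le_mul_of_nonneg_right ?_ (Real.rpow_pos_of_pos ht _).le
  rw [← Real.norm_eq_abs]
  refine tsum_of_norm_bounded (ha.summable_deriv_abs hν (T ^ ν)).hasSum fun n => ?_
  have := Real.Gamma_pos_of_pos (show 0 < ν * (n + 1) by positivity)
  rw [Real.norm_eq_abs, abs_div, abs_mul, abs_pow, abs_of_pos this]
  gcongr

theorem fracSeries_zero (hν : 0 < ν) : fracSeries ν a 0 = a 0 := by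
  rw [fracSeries, gammaSeries, Real.zero_rpow hν.ne', tsum_eq_single 0]
  · simp
  · intro m hm
    simp [hm]

end

/-! ### Caputo derivatives of fractional power series -/

section

variable {ν : ℝ} {a : ℕ → ℝ}

theorem AbsolutelyContinuousOnInterval.congr {f g : ℝ → ℝ} {a b : ℝ}
    (hf : AbsolutelyContinuousOnInterval f a b) (h : EqOn f g (uIcc a b)) :
    AbsolutelyContinuousOnInterval g a b := by
  rw [absolutelyContinuousOnInterval_iff] at hf ⊢
  intro ε hε
  obtain ⟨δ, hδ, H⟩ := hf ε hε
  refine ⟨δ, hδ, fun E hE hlt => ?_⟩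
  rw [← Finset.sum_congr rfl fun i hi => ?_]
  · exact H E hE hlt
  · rw [h (hE.1 i hi).1, h (hE.1 i hi).2]

/-- The Caputo derivative at `t > 0` depends only on the values of the function on `[0, ∞)`. -/
theorem HasCaputoDerivAt.congr {f g : ℝ → ℝ} {v t : ℝ} (hf : HasCaputoDerivAt ν f v t)
    (ht : 0 < t) (h : EqOn f g (Ici 0)) : HasCaputoDerivAt ν g v t := by
  have hev : ∀ s, 0 < s → f =ᶠ[𝓝 s] g := fun s hs =>
    h.eventuallyEq_of_mem (Ici_mem_nhds hs)
  rcases hf with ⟨h1, hd⟩ | ⟨h0, h1, hac, hint, hv⟩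
  · exact Or.inl ⟨h1, hd.congr_of_eventuallyEq (hev t ht).symm⟩
  · have hcongr : EqOn (fun s => deriv f s / (t - s) ^ ν) (fun s => deriv g s / (t - s) ^ ν)
        (uIoc 0 t) := fun s hs => by
      rw [uIoc_of_le ht.le] at hs
      simp only [(hev s hs.1).deriv_eq]
    refine Or.inr ⟨h0, h1, hac.congr fun s hs => h ?_, hint.congr hcongr, ?_⟩
    · rw [uIcc_of_le ht.le] at hs
      exact hs.1
    · rw [← hv, intervalIntegral.integral_congr_ae (ae_of_all _ hcongr)]

theorem intervalIntegrable_deriv_fracSeries (ha : GeomBounded a) (hν : 0 < ν) {t : ℝ}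
    (ht : 0 < t) : IntervalIntegrable (deriv (fracSeries ν a)) volume 0 t := by
  obtain ⟨B, hB⟩ := exists_abs_deriv_fracSeries_le ha hν t
  refine ((intervalIntegral.intervalIntegrable_rpow' (r := ν - 1) (by linarith)).const_mul
    B).mono_fun' (measurable_deriv _).aestronglyMeasurable ?_
  rw [uIoc_of_le ht.le]
  filter_upwards [ae_restrict_mem measurableSet_Ioc] with s hs
  exact hB s hs.1 hs.2

theorem absolutelyContinuousOnInterval_fracSeries (ha : GeomBounded a) (hν : 0 < ν) {t : ℝ}
    (ht : 0 < t) : AbsolutelyContinuousOnInterval (fracSeries ν a) 0 t := by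
  have hint := intervalIntegrable_deriv_fracSeries ha hν ht
  have hconst : AbsolutelyContinuousOnInterval (fun _ : ℝ => fracSeries ν a 0) 0 t :=
    (LipschitzWith.const (fracSeries ν a 0)).lipschitzOnWith.absolutelyContinuousOnInterval
  refine (hconst.add
    (hint.absolutelyContinuousOnInterval_intervalIntegral left_mem_uIcc)).congr fun x hx => ?_
  rw [uIcc_of_le ht.le] at hx
  simp only [Pi.add_apply]
  rw [intervalIntegral.integral_eq_sub_of_hasDerivAt_of_le hx.1
    (continuous_fracSeries ha hν).continuousOn
    (fun y hy => (hasDerivAt_fracSeries ha hν hy.1).differentiableAt.hasDerivAt)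
    (hint.mono_set (by rw [uIcc_of_le ht.le, uIcc_of_le hx.1]; exact Icc_subset_Icc_right hx.2))]
  ring

/-- Termwise integration: each term of the derivative contributes a Beta integral. -/
theorem integral_deriv_fracSeries_mul_rpow (ha : GeomBounded a) (hν : 0 < ν) (hν1 : ν < 1) {t : ℝ}
    (ht : 0 < t) :
    ∫ s in (0 : ℝ)..t, deriv (fracSeries ν a) s * (t - s) ^ (-ν) =
      Real.Gamma (1 - ν) * fracSeries ν (fun m => a (m + 1)) t := by
  have h1 : -ν = (1 - ν) - 1 := by ring
  -- `F n` is the `n`-th term of the derivative, times the kernel.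
  set F : ℕ → ℝ → ℝ := fun n s => a (n + 1) / Real.Gamma (ν * (n + 1)) *
    (s ^ (ν * (n + 1) - 1) * (t - s) ^ ((1 - ν) - 1)) with hF
  have hpos : ∀ n : ℕ, 0 < ν * ((n : ℝ) + 1) := fun n => by positivity
  have hint : ∀ n, IntegrableOn (F n) (Ioc 0 t) := fun n => by
    rw [← intervalIntegrable_iff_integrableOn_Ioc_of_le ht.le]
    exact (intervalIntegrable_rpow_mul_sub_rpow (hpos n) (by linarith) ht).const_mul _
  have hbeta : ∀ n : ℕ, (Real.Gamma (ν * (n + 1)))⁻¹ *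
      ∫ s in Ioc 0 t, s ^ (ν * (n + 1) - 1) * (t - s) ^ ((1 - ν) - 1) =
      Real.Gamma (1 - ν) * ((t ^ ν) ^ n / Real.Gamma (ν * n + 1)) := fun n => by
    have := Real.Gamma_pos_of_pos (hpos n)
    rw [← intervalIntegral.integral_of_le ht.le,
      integral_rpow_mul_sub_rpow (hpos n) (by linarith) ht,
      show ν * ((n : ℝ) + 1) + (1 - ν) = ν * n + 1 by ring, add_sub_cancel_right,
      Real.rpow_mul ht.le, Real.rpow_natCast]
    field_simp
  have hnorm : ∀ n, ∫ s in Ioc 0 t, ‖F n s‖ =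
      Real.Gamma (1 - ν) * (|a (n + 1)| * |t ^ ν| ^ n / Real.Gamma (ν * n + 1)) := fun n => by
    have hG := Real.Gamma_pos_of_pos (hpos n)
    have : ∀ s ∈ Ioc 0 t, ‖F n s‖ = |a (n + 1)| * (Real.Gamma (ν * (n + 1)))⁻¹ *
        (s ^ (ν * (n + 1) - 1) * (t - s) ^ ((1 - ν) - 1)) := fun s hs => by
      have h2 : 0 ≤ s ^ (ν * (n + 1) - 1) * (t - s) ^ ((1 - ν) - 1) :=
        mul_nonneg (Real.rpow_nonneg hs.1.le _) (Real.rpow_nonneg (sub_nonneg.2 hs.2) _)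
      rw [hF, Real.norm_eq_abs, abs_mul, abs_of_nonneg h2, abs_div, abs_of_pos hG, div_eq_mul_inv]
    rw [setIntegral_congr_fun measurableSet_Ioc this, integral_const_mul, mul_assoc, hbeta,
      abs_of_pos (Real.rpow_pos_of_pos ht ν)]
    ring
  have hs := hasSum_integral_of_summable_integral_norm hint
    (by simp only [hnorm]; exact (ha.shift.summable_abs hν (t ^ ν)).mul_left _)
  rw [intervalIntegral.integral_of_le ht.le, fracSeries, gammaSeries, ← tsum_mul_left]
  rw [setIntegral_congr_fun (g := fun s => ∑' n, F n s) measurableSet_Ioc, ← hs.tsum_eq]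
  · refine tsum_congr fun n => ?_
    simp only [hF]
    rw [integral_const_mul, div_eq_mul_inv, mul_assoc, hbeta]
    ring
  · intro s hs
    simp only [hF, h1]
    rw [← (hasSum_deriv_fracSeries ha hν hs.1).tsum_eq, ← tsum_mul_right]
    exact tsum_congr fun n => by ring

/-- The Caputo derivative of order `ν` acts on fractional power series as the shift of the
coefficients. -/
theorem hasCaputoDerivAt_fracSeries (ha : GeomBounded a) (hν : 0 < ν) (hν1 : ν ≤ 1) {t : ℝ}
    (ht : 0 < t) :
    HasCaputoDerivAt ν (fracSeries ν a) (fracSeries ν (fun m => a (m + 1)) t) t := by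
  rcases hν1.eq_or_lt with rfl | hν1
  · refine Or.inl ⟨rfl, (hasDerivAt_fracSeries ha hν ht).congr_deriv ?_⟩
    simp [fracSeries, gammaSeries, gammaSeriesDeriv]
  · have hcongr : EqOn (fun s => deriv (fracSeries ν a) s * (t - s) ^ (-ν))
        (fun s => deriv (fracSeries ν a) s / (t - s) ^ ν) (uIoc 0 t) := fun s hs => by
      rw [uIoc_of_le ht.le] at hs
      simp only [Real.rpow_neg (sub_nonneg.2 hs.2), div_eq_mul_inv]
    refine Or.inr ⟨hν, hν1, absolutelyContinuousOnInterval_fracSeries ha hν ht, ?_, ?_⟩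
    · obtain ⟨B, hB⟩ := exists_abs_deriv_fracSeries_le ha hν t
      refine ((intervalIntegrable_rpow_mul_sub_rpow hν (sub_pos.2 hν1) ht).const_mul B).mono_fun'
        ((measurable_deriv _).div (by fun_prop)).aestronglyMeasurable ?_
      rw [uIoc_of_le ht.le]
      filter_upwards [ae_restrict_mem measurableSet_Ioc] with s hs
      have h2 : 0 ≤ (t - s) ^ (-ν) := Real.rpow_nonneg (sub_nonneg.2 hs.2) _
      rw [div_eq_mul_inv, ← Real.rpow_neg (sub_nonneg.2 hs.2), norm_mul, Real.norm_eq_abs,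
        Real.norm_eq_abs, abs_of_nonneg h2, ← mul_assoc, show (1 - ν) - 1 = -ν by ring]
      exact mul_le_mul_of_nonneg_right (hB s hs.1 hs.2) h2
    · rw [← intervalIntegral.integral_congr_ae (ae_of_all _ hcongr),
        integral_deriv_fracSeries_mul_rpow ha hν hν1 ht]
      have := Real.Gamma_pos_of_pos (sub_pos.2 hν1)
      field_simp

end

/-! ### Abel inversion -/

section

variable {ν : ℝ}

/-- The Beta integral on `[τ, t]` whose exponents add up to `-1`; its value does not depend on the
endpoints, which is what makes Abel's inversion work. -/
theorem integral_sub_rpow_mul_sub_rpow (hν : 0 < ν) (hν1 : ν < 1) {τ t : ℝ} (h : τ < t) :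
    ∫ s in τ..t, (t - s) ^ (ν - 1) * (s - τ) ^ (-ν) = Real.Gamma ν * Real.Gamma (1 - ν) := by
  have h1 := integral_rpow_mul_sub_rpow (sub_pos.2 hν1) hν (sub_pos.2 h)
  rw [show 1 - ν + ν = 1 by ring, sub_self, Real.rpow_zero, Real.Gamma_one, one_mul, div_one] at h1
  have h2 := intervalIntegral.integral_comp_sub_right
    (fun x : ℝ => x ^ (1 - ν - 1) * (t - τ - x) ^ (ν - 1)) (a := τ) (b := t) τ
  rw [sub_self, h1] at h2
  rw [mul_comm (Real.Gamma ν), ← h2]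
  refine intervalIntegral.integral_congr fun s _ => ?_
  rw [show t - τ - (s - τ) = t - s by ring, show 1 - ν - 1 = -ν by ring, mul_comm]

/-- Abel's inversion: the fractional integral of order `ν` of the fractional integral of order
`1 - ν` is the ordinary integral. -/
theorem integral_sub_rpow_mul_integral (hν : 0 < ν) (hν1 : ν < 1) {g : ℝ → ℝ} {t : ℝ}
    (ht : 0 < t) (hg : IntervalIntegrable g volume 0 t) (hgm : Measurable g) :
    ∫ s in (0 : ℝ)..t, (t - s) ^ (ν - 1) * ∫ τ in (0 : ℝ)..s, g τ / (s - τ) ^ ν =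
      Real.Gamma ν * Real.Gamma (1 - ν) * ∫ s in (0 : ℝ)..t, g s := by
  set B := Real.Gamma ν * Real.Gamma (1 - ν) with hBdef
  have hB : 0 < B := mul_pos (Real.Gamma_pos_of_pos hν) (Real.Gamma_pos_of_pos (sub_pos.2 hν1))
  set μ := volume.restrict (Ioc (0 : ℝ) t) with hμ
  -- The kernel, extended by zero to the triangle `s ≤ τ`, so that Fubini applies on a square.
  set κ : ℝ → ℝ → ℝ := fun s τ => (Ioi τ).indicator (fun s => (t - s) ^ (ν - 1) * (s - τ) ^ (-ν)) s
    with hκ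
  have hκm : Measurable fun p : ℝ × ℝ => κ p.1 p.2 := by
    have : (fun p : ℝ × ℝ => κ p.1 p.2) = {p : ℝ × ℝ | p.2 < p.1}.indicator
        fun p => (t - p.1) ^ (ν - 1) * (p.1 - p.2) ^ (-ν) := by
      ext p; simp [hκ, indicator]
    rw [this]
    exact Measurable.indicator (by fun_prop) (measurableSet_lt measurable_snd measurable_fst)
  have hκ0 : ∀ s τ, s ∈ Ioc 0 t → 0 ≤ κ s τ := fun s τ hs => by
    refine indicator_apply_nonneg fun h => ?_
    exact mul_nonneg (Real.rpow_nonneg (sub_nonneg.2 hs.2) _)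
      (Real.rpow_nonneg (sub_nonneg.2 (le_of_lt h)) _)
  have hκint : ∀ τ, τ ∈ Ioo 0 t → ∫ s, κ s τ ∂μ = B := fun τ hτ => by
    simp only [hκ]
    rw [setIntegral_indicator measurableSet_Ioi, Ioc_inter_Ioi, max_eq_right hτ.1.le,
      ← intervalIntegral.integral_of_le hτ.2.le, integral_sub_rpow_mul_sub_rpow hν hν1 hτ.2]
  have hκi : ∀ τ, τ ∈ Ioo 0 t → Integrable (fun s => κ s τ) μ := fun τ hτ =>
    .of_integral_ne_zero (by rw [hκint τ hτ]; exact hB.ne')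
  have hgi : Integrable g μ := (intervalIntegrable_iff_integrableOn_Ioc_of_le ht.le).1 hg
  have hae : ∀ᵐ τ ∂μ, τ ∈ Ioo 0 t := by
    rw [hμ, ← restrict_Ioo_eq_restrict_Ioc]
    exact ae_restrict_mem measurableSet_Ioo
  have hH : Integrable (Function.uncurry fun s τ => κ s τ * g τ) (μ.prod μ) := by
    have hm : AEStronglyMeasurable (Function.uncurry fun s τ => κ s τ * g τ) (μ.prod μ) :=
      (hκm.mul (hgm.comp measurable_snd)).aestronglyMeasurable
    refine (integrable_prod_iff' hm).2 ⟨?_, ?_⟩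
    · filter_upwards [hae] with τ hτ
      simpa [Function.uncurry] using (hκi τ hτ).mul_const (g τ)
    · refine (hgi.norm.const_mul B).congr ?_
      filter_upwards [hae] with τ hτ
      rw [← hκint τ hτ, ← integral_mul_const]
      refine setIntegral_congr_fun measurableSet_Ioc fun s hs => ?_
      simp only [Function.uncurry, norm_mul]
      rw [Real.norm_of_nonneg (hκ0 s τ hs)]
  have hswap := integral_integral_swap hH
  rw [intervalIntegral.integral_of_le ht.le, intervalIntegral.integral_of_le ht.le,
    ← integral_const_mul]
  have hR : ∫ τ, ∫ s, κ s τ * g τ ∂μ ∂μ = ∫ τ, B * g τ ∂μ := by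
    refine integral_congr_ae ?_
    filter_upwards [hae] with τ hτ
    rw [integral_mul_const, hκint τ hτ]
  rw [← hR, ← hswap]
  refine setIntegral_congr_fun measurableSet_Ioc fun s hs => ?_
  rw [intervalIntegral.integral_of_le hs.1.le, ← integral_const_mul,
    integral_Ioc_eq_integral_Ioo]
  have hind : ∀ τ, κ s τ * g τ = (Iio s).indicator
      (fun τ => (t - s) ^ (ν - 1) * (s - τ) ^ (-ν) * g τ) τ := fun τ => by
    by_cases h : τ < s <;> simp [hκ, indicator, h]
  simp only [hind]
  rw [hμ, setIntegral_indicator measurableSet_Iio,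
    show Ioc 0 t ∩ Iio s = Ioo 0 s by ext x; simp; grind]
  refine setIntegral_congr_fun measurableSet_Ioo fun τ hτ => ?_
  rw [Real.rpow_neg (sub_nonneg.2 hτ.2.le)]
  ring

/-- A solution of the fractional differential equation `d^ν f / dt^ν = v` solves the corresponding
Volterra integral equation. -/
theorem eq_add_fractional_integral (hν : 0 < ν) {f v : ℝ → ℝ} (hfc : ContinuousOn f (Ici 0))
    (hvc : ContinuousOn v (Ici 0)) (hf : ∀ t, 0 < t → HasCaputoDerivAt ν f (v t) t) {t : ℝ}
    (ht : 0 < t) :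
    f t = f 0 + 1 / Real.Gamma ν * ∫ s in (0 : ℝ)..t, (t - s) ^ (ν - 1) * v s := by
  rcases hf t ht with ⟨rfl, -⟩ | ⟨-, hν1, hac, -, -⟩
  · have hd : ∀ s, 0 < s → HasDerivAt f (v s) s := fun s hs => by
      rcases hf s hs with ⟨-, h⟩ | ⟨-, h, -⟩
      · exact h
      · exact absurd h (lt_irrefl _)
    have hsub : uIcc 0 t ⊆ Ici 0 := by rw [uIcc_of_le ht.le]; exact Icc_subset_Ici_self
    have := intervalIntegral.integral_eq_sub_of_hasDerivAt_of_le ht.le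
      (hfc.mono Icc_subset_Ici_self) (fun s hs => hd s hs.1)
      (hvc.mono hsub).intervalIntegrable
    simp [this]
  · have hG := Real.Gamma_pos_of_pos hν
    have hG1 := Real.Gamma_pos_of_pos (sub_pos.2 hν1)
    have key := integral_sub_rpow_mul_integral hν hν1 ht hac.intervalIntegrable_deriv
      (measurable_deriv f)
    rw [hac.integral_deriv_eq_sub] at key
    have hcongr : ∫ s in (0 : ℝ)..t, (t - s) ^ (ν - 1) *
        ∫ τ in (0 : ℝ)..s, deriv f τ / (s - τ) ^ ν =
        ∫ s in (0 : ℝ)..t, Real.Gamma (1 - ν) * ((t - s) ^ (ν - 1) * v s) := by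
      refine intervalIntegral.integral_congr_ae (ae_of_all _ fun s hs => ?_)
      rw [uIoc_of_le ht.le] at hs
      rcases hf s hs.1 with ⟨h, -⟩ | ⟨-, -, -, -, h⟩
      · exact absurd h hν1.ne
      · simp only [← h]
        field_simp
    rw [hcongr, intervalIntegral.integral_const_mul] at key
    have : ∫ s in (0 : ℝ)..t, (t - s) ^ (ν - 1) * v s = Real.Gamma ν * (f t - f 0) :=
      mul_left_cancel₀ hG1.ne' (by rw [key]; ring)
    rw [this]
    field_simp
    ring

end

/-! ### Uniqueness for the Volterra equation -/

section

variable {ν : ℝ}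

theorem intervalIntegrable_sub_rpow_mul (hν : 0 < ν) {v : ℝ → ℝ} (hv : ContinuousOn v (Ici 0))
    {t : ℝ} (ht : 0 ≤ t) :
    IntervalIntegrable (fun s => (t - s) ^ (ν - 1) * v s) volume 0 t := by
  have h : IntervalIntegrable (fun s : ℝ => (t - s) ^ (ν - 1)) volume 0 t := by
    simpa using ((intervalIntegral.intervalIntegrable_rpow' (a := 0) (b := t) (r := ν - 1)
      (by linarith)).comp_sub_left t).symm
  refine h.mul_continuousOn (hv.mono ?_)
  rw [uIcc_of_le ht]
  exact Icc_subset_Ici_self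

theorem integral_sub_rpow_mul_exp_le (hν : 0 < ν) {c t : ℝ} (hc : 0 < c) (ht : 0 ≤ t) :
    ∫ s in (0 : ℝ)..t, (t - s) ^ (ν - 1) * Real.exp (c * s) ≤
      Real.exp (c * t) * (Real.Gamma ν / c ^ ν) := by
  have key := Real.integral_rpow_mul_exp_neg_mul_Ioi hν hc
  have hint : IntegrableOn (fun x : ℝ => x ^ (ν - 1) * Real.exp (-(c * x))) (Ioi 0) := by
    refine .of_integral_ne_zero ?_
    rw [key]
    have := Real.Gamma_pos_of_pos hν
    positivity
  have hsub := intervalIntegral.integral_comp_sub_left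
    (fun x : ℝ => Real.exp (c * t) * (x ^ (ν - 1) * Real.exp (-(c * x)))) (a := 0) (b := t) t
  rw [sub_self, sub_zero] at hsub
  calc ∫ s in (0 : ℝ)..t, (t - s) ^ (ν - 1) * Real.exp (c * s)
      = Real.exp (c * t) * ∫ x in (0 : ℝ)..t, x ^ (ν - 1) * Real.exp (-(c * x)) := by
        rw [← intervalIntegral.integral_const_mul, ← hsub]
        refine intervalIntegral.integral_congr fun s _ => ?_
        rw [mul_left_comm, ← Real.exp_add]
        ring_nf
    _ ≤ Real.exp (c * t) * ∫ x in Ioi (0 : ℝ), x ^ (ν - 1) * Real.exp (-(c * x)) := by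
        refine mul_le_mul_of_nonneg_left ?_ (Real.exp_pos _).le
        rw [intervalIntegral.integral_of_le ht]
        refine setIntegral_mono_set hint ?_ Ioc_subset_Ioi_self.eventuallyLE
        filter_upwards [ae_restrict_mem measurableSet_Ioi] with x hx
        have : (0 : ℝ) < x := hx
        positivity
    _ = _ := by
        rw [key, one_div, Real.inv_rpow hc.le]
        ring

/-- The homogeneous Volterra equation with the kernel `(t - s)^(ν - 1)` has only the zero solution
among continuous functions: in the norm `sup |u(s)| e^(-c s)`, with `c` large, the integral operator
is a strict contraction. -/
theorem eq_zero_of_eq_fractional_integral (hν : 0 < ν) {κ : ℝ} {u : ℝ → ℝ}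
    (huc : ContinuousOn u (Ici 0))
    (hu : ∀ t, 0 ≤ t → u t = κ * ∫ s in (0 : ℝ)..t, (t - s) ^ (ν - 1) * u s) {t : ℝ}
    (ht : 0 ≤ t) : u t = 0 := by
  have hG := Real.Gamma_pos_of_pos hν
  -- With this `c`, the operator has norm at most `|κ| Γ(ν) / c^ν < 1`.
  obtain ⟨c, hc, hcν⟩ : ∃ c : ℝ, 0 < c ∧ c ^ ν = |κ| * Real.Gamma ν + 1 :=
    ⟨(|κ| * Real.Gamma ν + 1) ^ ν⁻¹, by positivity, Real.rpow_inv_rpow (by positivity) hν.ne'⟩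
  obtain ⟨t₀, ht₀, hmax⟩ := isCompact_Icc.exists_isMaxOn (nonempty_Icc.2 ht)
    (f := fun s => |u s| * Real.exp (-(c * s)))
    (((huc.mono Icc_subset_Ici_self).abs).mul (by fun_prop))
  set M := |u t₀| * Real.exp (-(c * t₀)) with hM
  have hM0 : 0 ≤ M := by positivity
  have hle : ∀ s ∈ Icc 0 t, |u s| ≤ M * Real.exp (c * s) := fun s hs => by
    have h : |u s| * Real.exp (-(c * s)) ≤ M := hmax hs
    rwa [Real.exp_neg, ← div_eq_mul_inv, div_le_iff₀ (Real.exp_pos _)] at h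
  have hbound : |u t₀| ≤ |κ| * (M * (Real.exp (c * t₀) * (Real.Gamma ν / c ^ ν))) := by
    rw [hu t₀ ht₀.1, abs_mul]
    refine mul_le_mul_of_nonneg_left ?_ (abs_nonneg _)
    rw [← Real.norm_eq_abs]
    refine (intervalIntegral.norm_integral_le_of_norm_le
      (g := fun s => M * ((t₀ - s) ^ (ν - 1) * Real.exp (c * s))) ht₀.1
      (ae_of_all _ fun s hs => ?_)
      ((intervalIntegrable_sub_rpow_mul hν (by fun_prop) ht₀.1).const_mul M)).trans ?_
    · rw [norm_mul, Real.norm_of_nonneg (Real.rpow_nonneg (sub_nonneg.2 hs.2) _), mul_left_comm]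
      exact mul_le_mul_of_nonneg_left (hle s ⟨hs.1.le, hs.2.trans ht₀.2⟩)
        (Real.rpow_nonneg (sub_nonneg.2 hs.2) _)
    · rw [intervalIntegral.integral_const_mul]
      exact mul_le_mul_of_nonneg_left (integral_sub_rpow_mul_exp_le hν hc ht₀.1) hM0
  have hcontr : M * (|κ| * Real.Gamma ν + 1) ≤ M * (|κ| * Real.Gamma ν) := by
    have h := mul_le_mul_of_nonneg_right hbound (Real.exp_pos (-(c * t₀))).le
    rw [← hM, hcν] at h
    have hexp : Real.exp (c * t₀) * Real.exp (-(c * t₀)) = 1 := by rw [← Real.exp_add]; simp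
    rw [show |κ| * (M * (Real.exp (c * t₀) * (Real.Gamma ν / (|κ| * Real.Gamma ν + 1)))) *
      Real.exp (-(c * t₀)) = M * (|κ| * Real.Gamma ν) / (|κ| * Real.Gamma ν + 1) *
        (Real.exp (c * t₀) * Real.exp (-(c * t₀))) by ring, hexp, mul_one,
      le_div_iff₀ (by positivity)] at h
    exact h
  have hMz : M = 0 := le_antisymm (by linarith) hM0
  simpa [hMz] using hle t ⟨ht, le_rfl⟩

end

/-! ### The explicit formula as a fractional power series -/

open Polynomial in
/-- The generating polynomial `λ_1 X + ⋯ + λ_k X^k` of the jump rates. -/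
def jumpPoly (k : ℕ) (lam : ℕ → ℝ) : ℝ[X] := ∑ i ∈ Finset.Icc 1 k, C (lam i) * X ^ i

/-- The sequence `m ↦ binom(m, r) L^(m - r)`; it vanishes for `m < r`, where the exponent is
truncated. -/
def binomCoeff (L : ℝ) (r m : ℕ) : ℝ := m.choose r * L ^ (m - r)

/-- The coefficients of `fracPmf k lam ν j` as a fractional power series in `t^ν`. -/
def pmfCoeff (k : ℕ) (lam : ℕ → ℝ) (j m : ℕ) : ℝ :=
  ∑ r ∈ Finset.range (j + 1), (jumpPoly k lam ^ r).coeff j * binomCoeff (-totalRate k lam) r m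

open Polynomial in
/-- The multinomial theorem, read off coefficientwise. -/
theorem sum_jumpIndices (k : ℕ) (lam : ℕ → ℝ) (r j : ℕ) :
    ∑ α ∈ jumpIndices k r j, (Nat.multinomial (Finset.Icc 1 k) α : ℝ) *
      ∏ i ∈ Finset.Icc 1 k, lam i ^ α i = (jumpPoly k lam ^ r).coeff j := by
  rw [jumpPoly, Finset.sum_pow_eq_sum_piAntidiag, finsetSum_coeff, jumpIndices, Finset.sum_filter]
  refine Finset.sum_congr rfl fun α _ => ?_
  have : (Nat.multinomial (Finset.Icc 1 k) α : ℝ[X]) *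
      ∏ i ∈ Finset.Icc 1 k, (C (lam i) * X ^ i) ^ α i =
      C ((Nat.multinomial (Finset.Icc 1 k) α : ℝ) * ∏ i ∈ Finset.Icc 1 k, lam i ^ α i) *
        X ^ (∑ i ∈ Finset.Icc 1 k, i * α i) := by
    simp only [mul_pow, Finset.prod_mul_distrib, ← pow_mul, Finset.prod_pow_eq_pow_sum, map_mul,
      map_prod, map_pow, map_natCast, mul_assoc]
  rw [this, coeff_C_mul, coeff_X_pow]
  simp [eq_comm]

open Polynomial in
theorem coeff_jumpPoly_pow_succ (k : ℕ) (lam : ℕ → ℝ) (r j : ℕ) :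
    (jumpPoly k lam ^ (r + 1)).coeff j =
      ∑ i ∈ Finset.Icc 1 (min j k), lam i * (jumpPoly k lam ^ r).coeff (j - i) := by
  rw [pow_succ', jumpPoly, Finset.sum_mul, finsetSum_coeff, ← jumpPoly]
  have : Finset.Icc 1 (min j k) = (Finset.Icc 1 k).filter (· ≤ j) := by ext; simp; grind
  rw [this, Finset.sum_filter]
  refine Finset.sum_congr rfl fun i _ => ?_
  rw [mul_assoc, coeff_C_mul, coeff_X_pow_mul']
  simp

theorem coeff_jumpPoly_pow_eq_zero (k : ℕ) (lam : ℕ → ℝ) {r j : ℕ} (h : j < r) :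
    (jumpPoly k lam ^ r).coeff j = 0 := by
  induction r generalizing j with
  | zero => omega
  | succ r ih =>
    rw [coeff_jumpPoly_pow_succ]
    refine Finset.sum_eq_zero fun i hi => ?_
    rw [Finset.mem_Icc] at hi
    rw [ih (by omega), mul_zero]

theorem binomCoeff_zero_succ (L : ℝ) (m : ℕ) : binomCoeff L 0 (m + 1) = L * binomCoeff L 0 m := by
  simp [binomCoeff, pow_succ']

theorem binomCoeff_succ_succ (L : ℝ) (r m : ℕ) :
    binomCoeff L (r + 1) (m + 1) = binomCoeff L r m + L * binomCoeff L (r + 1) m := by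
  rcases lt_or_ge r m with h | h
  · obtain ⟨d, rfl⟩ := Nat.exists_eq_add_of_lt h
    simp only [binomCoeff, Nat.choose_succ_succ' (r + d + 1) r, Nat.cast_add]
    rw [show r + d + 1 + 1 - (r + 1) = d + 1 by omega, show r + d + 1 - r = d + 1 by omega,
      show r + d + 1 - (r + 1) = d by omega]
    ring
  · simp [binomCoeff, Nat.choose_succ_succ' m r, Nat.choose_eq_zero_of_lt (show m < r + 1 by omega)]

theorem binomCoeff_right_zero (L : ℝ) (r : ℕ) : binomCoeff L r 0 = if r = 0 then 1 else 0 := by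
  rcases r with _ | r <;> simp [binomCoeff]

theorem abs_binomCoeff_le (L : ℝ) (r m : ℕ) : |binomCoeff L r m| ≤ (2 * (1 + |L|)) ^ m := by
  rw [binomCoeff, abs_mul, Nat.abs_cast, abs_pow, mul_pow]
  have h1 : (m.choose r : ℝ) ≤ 2 ^ m := by exact_mod_cast Nat.choose_le_two_pow m r
  have h2 : |L| ^ (m - r) ≤ (1 + |L|) ^ m :=
    (pow_le_pow_left₀ (abs_nonneg L) (by linarith) _).trans
      (pow_le_pow_right₀ (by linarith [abs_nonneg L]) (Nat.sub_le m r))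
  gcongr

theorem geomBounded_binomCoeff (L : ℝ) (r : ℕ) : GeomBounded (binomCoeff L r) :=
  ⟨1, 2 * (1 + |L|), zero_le_one, by positivity, fun m => by
    rw [one_mul]; exact abs_binomCoeff_le L r m⟩

theorem geomBounded_pmfCoeff (k : ℕ) (lam : ℕ → ℝ) (j : ℕ) : GeomBounded (pmfCoeff k lam j) := by
  refine ⟨∑ r ∈ Finset.range (j + 1), |(jumpPoly k lam ^ r).coeff j|,
    2 * (1 + |-totalRate k lam|), Finset.sum_nonneg fun _ _ => abs_nonneg _, by positivity,
    fun m => ?_⟩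
  rw [Finset.sum_mul]
  refine (Finset.abs_sum_le_sum_abs _ _).trans (Finset.sum_le_sum fun r _ => ?_)
  rw [abs_mul]
  exact mul_le_mul_of_nonneg_left (abs_binomCoeff_le _ _ _) (abs_nonneg _)

/-- The fractional difference-differential equations, on the level of coefficients. -/
theorem pmfCoeff_succ (k : ℕ) (lam : ℕ → ℝ) (j m : ℕ) :
    pmfCoeff k lam j (m + 1) =
      ∑ i ∈ Finset.Icc 1 (min j k), lam i * pmfCoeff k lam (j - i) m -
        totalRate k lam * pmfCoeff k lam j m := by
  have hext : ∀ i ∈ Finset.Icc 1 (min j k), pmfCoeff k lam (j - i) m =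
      ∑ r ∈ Finset.range j, (jumpPoly k lam ^ r).coeff (j - i) *
        binomCoeff (-totalRate k lam) r m := fun i hi => by
    rw [Finset.mem_Icc] at hi
    refine Finset.sum_subset (Finset.range_subset_range.2 (by omega)) fun r _ hr => ?_
    rw [coeff_jumpPoly_pow_eq_zero k lam (by simpa using hr), zero_mul]
  rw [Finset.sum_congr rfl fun i hi => by rw [hext i hi]]
  simp only [pmfCoeff]
  rw [Finset.sum_range_succ', Finset.sum_range_succ' _ j]
  simp only [binomCoeff_succ_succ, binomCoeff_zero_succ, mul_add, Finset.sum_add_distrib,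
    coeff_jumpPoly_pow_succ, Finset.sum_mul, Finset.mul_sum]
  rw [Finset.sum_comm]
  simp only [mul_assoc, neg_mul, mul_neg, Finset.sum_neg_distrib, mul_left_comm (totalRate k lam)]
  ring

theorem pmfCoeff_zero (k : ℕ) (lam : ℕ → ℝ) (j : ℕ) :
    pmfCoeff k lam j 0 = if j = 0 then 1 else 0 := by
  simp [pmfCoeff, binomCoeff_right_zero, Polynomial.coeff_one]

theorem ascPochhammer_eval_div_factorial (r n : ℕ) :
    (ascPochhammer ℝ n).eval ((r : ℝ) + 1) / n.factorial = (n + r).choose r := by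
  rw [← Nat.cast_add_one, ← ascPochhammer_eval_cast, ascPochhammer_nat_eq_ascFactorial,
    Nat.ascFactorial_eq_factorial_mul_choose, Nat.cast_mul,
    mul_div_cancel_left₀ _ (by positivity), add_comm n r, Nat.choose_symm_add]

/-- The terms of the Mittag-Leffler series, written with the coefficients `binomCoeff x r` at the
point `1`; keeping `x` in the coefficients avoids dividing by it. -/
theorem genMittagLeffler_term (ν x : ℝ) (r n : ℕ) :
    (ascPochhammer ℝ n).eval ((r : ℝ) + 1) * x ^ n /
        ((n.factorial : ℝ) * Real.Gamma (ν * n + ((r : ℝ) * ν + 1))) =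
      binomCoeff x r (n + r) * 1 ^ (n + r) / Real.Gamma (ν * (n + r : ℕ) + 1) := by
  rw [binomCoeff, ← ascPochhammer_eval_div_factorial, Nat.add_sub_cancel, one_pow, mul_one,
    Nat.cast_add, show ν * ((n : ℝ) + r) + 1 = ν * n + (r * ν + 1) by ring]
  ring

theorem summable_genMittagLeffler {ν : ℝ} (hν : 0 < ν) (x : ℝ) (r : ℕ) :
    Summable fun n : ℕ => (ascPochhammer ℝ n).eval ((r : ℝ) + 1) * x ^ n /
      ((n.factorial : ℝ) * Real.Gamma (ν * n + ((r : ℝ) * ν + 1))) := by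
  simp only [genMittagLeffler_term]
  exact (summable_nat_add_iff r).2 ((geomBounded_binomCoeff x r).summable hν 1)

theorem pow_mul_genMittagLeffler {ν : ℝ} (hν : 0 < ν) (L z : ℝ) (r : ℕ) :
    z ^ r * genMittagLeffler ν ((r : ℝ) * ν + 1) ((r : ℝ) + 1) (L * z) =
      gammaSeries ν (binomCoeff L r) z := by
  have hs := (geomBounded_binomCoeff L r).summable hν z
  rw [gammaSeries, ← hs.sum_add_tsum_nat_add r, Finset.sum_eq_zero, zero_add, genMittagLeffler,
    ← tsum_mul_left]
  · refine tsum_congr fun n => ?_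
    rw [genMittagLeffler_term, binomCoeff, binomCoeff, Nat.add_sub_cancel, mul_pow]
    ring
  · intro m hm
    simp [binomCoeff, Nat.choose_eq_zero_of_lt (Finset.mem_range.1 hm)]

theorem gammaSeries_sum {ι : Type*} {ν : ℝ} (hν : 0 < ν) (s : Finset ι) (c : ι → ℝ)
    {a : ι → ℕ → ℝ} (ha : ∀ i, GeomBounded (a i)) (z : ℝ) :
    gammaSeries ν (fun m => ∑ i ∈ s, c i * a i m) z = ∑ i ∈ s, c i * gammaSeries ν (a i) z := by
  simp only [gammaSeries, Finset.sum_mul, Finset.sum_div]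
  rw [Summable.tsum_finsetSum fun i _ => (((ha i).summable hν z).mul_left (c i)).congr fun m => by
    ring]
  refine Finset.sum_congr rfl fun i _ => ?_
  rw [← tsum_mul_left]
  exact tsum_congr fun m => by ring

theorem fracPmf_eq_fracSeries {ν : ℝ} (hν : 0 < ν) (k : ℕ) (lam : ℕ → ℝ) (j : ℕ) {t : ℝ}
    (ht : 0 ≤ t) : fracPmf k lam ν j t = fracSeries ν (pmfCoeff k lam j) t := by
  have h := gammaSeries_sum hν (Finset.range (j + 1)) (fun r => (jumpPoly k lam ^ r).coeff j)
    (a := binomCoeff (-totalRate k lam)) (geomBounded_binomCoeff _) (t ^ ν)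
  refine Eq.trans ?_ h.symm
  rw [fracPmf]
  refine Finset.sum_congr rfl fun r _ => ?_
  rw [← pow_mul_genMittagLeffler hν, ← sum_jumpIndices, Finset.sum_mul, ← Real.rpow_natCast,
    ← Real.rpow_mul ht, mul_comm ν]
  exact Finset.sum_congr rfl fun α _ => by ring

theorem fracSeries_pmfCoeff_succ {ν : ℝ} (hν : 0 < ν) (k : ℕ) (lam : ℕ → ℝ) (j : ℕ) (t : ℝ) :
    fracSeries ν (fun m => pmfCoeff k lam j (m + 1)) t =
      ∑ i ∈ Finset.Icc 1 (min j k), lam i * fracSeries ν (pmfCoeff k lam (j - i)) t -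
        totalRate k lam * fracSeries ν (pmfCoeff k lam j) t := by
  have hb := fun i => geomBounded_pmfCoeff k lam (j - i)
  simp only [fracSeries]
  rw [← gammaSeries_sum hν _ lam hb]
  simp only [gammaSeries, pmfCoeff_succ]
  rw [← tsum_mul_left, ← Summable.tsum_sub]
  · exact tsum_congr fun m => by ring
  · simp only [Finset.sum_mul, Finset.sum_div]
    exact summable_sum fun i _ => (((hb i).summable hν (t ^ ν)).mul_left (lam i)).congr fun m => by ring
  · exact ((geomBounded_pmfCoeff k lam j).summable hν _).mul_left _

/-! ### Existence and uniqueness for the Cauchy problem -/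

section

variable {k : ℕ} {lam : ℕ → ℝ} {ν : ℝ}

/-- The three forms of the equation in one; for `j = 0` the sum is empty. -/
theorem IsCauchySolution.hasCaputoDerivAt {p : ℕ → ℝ → ℝ} (hp : IsCauchySolution k lam ν p)
    (j : ℕ) {t : ℝ} (ht : 0 < t) : HasCaputoDerivAt ν (p j)
      (∑ r ∈ Finset.Icc 1 (min j k), lam r * p (j - r) t - totalRate k lam * p j t) t := by
  rcases lt_or_ge j k with h | h
  · rw [min_eq_left h.le]
    rcases Nat.eq_zero_or_pos j with rfl | hj
    · simpa using hp.eq_zero t ht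
    · exact hp.eq_low j hj h t ht
  · rw [min_eq_right h]
    exact hp.eq_high j h t ht

theorem isCauchySolution_fracPmf (hν0 : 0 < ν) (hν1 : ν ≤ 1) :
    IsCauchySolution k lam ν (fracPmf k lam ν) := by
  have heq : ∀ j, EqOn (fracSeries ν (pmfCoeff k lam j)) (fracPmf k lam ν j) (Ici 0) :=
    fun j t ht => (fracPmf_eq_fracSeries hν0 k lam j ht).symm
  have hD : ∀ j t, 0 < t → HasCaputoDerivAt ν (fracPmf k lam ν j)
      (∑ r ∈ Finset.Icc 1 (min j k), lam r * fracPmf k lam ν (j - r) t -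
        totalRate k lam * fracPmf k lam ν j t) t := fun j t ht => by
    have h := (hasCaputoDerivAt_fracSeries (geomBounded_pmfCoeff k lam j) hν0 hν1 ht).congr ht
      (heq j)
    rw [fracSeries_pmfCoeff_succ hν0] at h
    simpa only [heq _ (show t ∈ Ici 0 from ht.le)] using h
  have h0 : ∀ j, fracPmf k lam ν j 0 = if j = 0 then 1 else 0 := fun j => by
    rw [fracPmf_eq_fracSeries hν0 k lam j le_rfl, fracSeries_zero hν0, pmfCoeff_zero]
  exact
    { continuousOn := fun j =>
        (continuous_fracSeries (geomBounded_pmfCoeff k lam j) hν0).continuousOn.congr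
          fun t ht => (heq j ht).symm
      eq_zero := fun t ht => by simpa using hD 0 t ht
      eq_low := fun j _ hjk t ht => by simpa [min_eq_left hjk.le] using hD j t ht
      eq_high := fun j hkj t ht => by simpa [min_eq_right hkj] using hD j t ht
      init_zero := by simp [h0]
      init_pos := fun j hj => by rw [h0, if_neg (by omega)] }

theorem IsCauchySolution.eqOn {p q : ℕ → ℝ → ℝ} (hν : 0 < ν) (hp : IsCauchySolution k lam ν p)
    (hq : IsCauchySolution k lam ν q) (j : ℕ) : EqOn (p j) (q j) (Ici 0) := by
  induction j using Nat.strong_induction_on with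
  | _ j ih =>
    have hcont : ∀ {p : ℕ → ℝ → ℝ}, IsCauchySolution k lam ν p → ContinuousOn (fun t =>
        ∑ r ∈ Finset.Icc 1 (min j k), lam r * p (j - r) t - totalRate k lam * p j t) (Ici 0) :=
      fun hp => (continuousOn_finsetSum _ fun r _ => (hp.continuousOn _).const_mul _).sub
        ((hp.continuousOn j).const_mul _)
    have hinit : p j 0 = q j 0 := by
      rcases Nat.eq_zero_or_pos j with rfl | hj
      · rw [hp.init_zero, hq.init_zero]
      · rw [hp.init_pos j hj, hq.init_pos j hj]
    intro t ht
    refine sub_eq_zero.1 (eq_zero_of_eq_fractional_integral hν (u := fun t => p j t - q j t)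
      (κ := 1 / Real.Gamma ν * -totalRate k lam)
      ((hp.continuousOn j).sub (hq.continuousOn j)) (fun s hs => ?_) ht)
    rcases (show (0 : ℝ) ≤ s from hs).eq_or_lt with rfl | hs
    · simp [hinit]
    rw [eq_add_fractional_integral hν (hp.continuousOn j) (hcont hp)
        (fun t ht => hp.hasCaputoDerivAt j ht) hs,
      eq_add_fractional_integral hν (hq.continuousOn j) (hcont hq)
        (fun t ht => hq.hasCaputoDerivAt j ht) hs, hinit, add_sub_add_left_eq_sub, ← mul_sub,
      ← intervalIntegral.integral_sub (intervalIntegrable_sub_rpow_mul hν (hcont hp) hs.le)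
        (intervalIntegrable_sub_rpow_mul hν (hcont hq) hs.le), mul_assoc,
      ← intervalIntegral.integral_const_mul (-totalRate k lam)]
    congr 1
    refine intervalIntegral.integral_congr fun x hx => ?_
    rw [uIcc_of_le hs.le] at hx
    have hsum : ∑ r ∈ Finset.Icc 1 (min j k), lam r * p (j - r) x =
        ∑ r ∈ Finset.Icc 1 (min j k), lam r * q (j - r) x := by
      refine Finset.sum_congr rfl fun r hr => ?_
      rw [Finset.mem_Icc] at hr
      rw [ih (j - r) (by omega) hx.1]
    simp only [hsum]
    ring

end

end

theorem mainTheorem4 (k : ℕ) (hk : 1 ≤ k) (lam : ℕ → ℝ)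
    (hlam : ∀ i, 1 ≤ i → i ≤ k → 0 < lam i) (ν : ℝ) (hν0 : 0 < ν) (hν1 : ν ≤ 1) :
    (∀ (r : ℕ) (t : ℝ), 0 ≤ t → Summable (fun n : ℕ =>
      (ascPochhammer ℝ n).eval ((r : ℝ) + 1) * (-totalRate k lam * t ^ ν) ^ n /
        ((n.factorial : ℝ) * Real.Gamma (ν * n + ((r : ℝ) * ν + 1))))) ∧
    IsCauchySolution k lam ν (fracPmf k lam ν) ∧
    (∀ j, DifferentiableOn ℝ (fracPmf k lam ν j) (Set.Ioi 0)) ∧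
    ∀ p : ℕ → ℝ → ℝ, IsCauchySolution k lam ν p →
      ∀ j : ℕ, ∀ t : ℝ, 0 ≤ t → p j t = fracPmf k lam ν j t := by
  have hsol : IsCauchySolution k lam ν (fracPmf k lam ν) := isCauchySolution_fracPmf hν0 hν1
  refine ⟨fun r t _ => summable_genMittagLeffler hν0 _ r, hsol, fun j => ?_,
    fun p hp j t ht => hp.eqOn hν0 hsol j ht⟩
  refine DifferentiableOn.congr (f := fracSeries ν (pmfCoeff k lam j)) (fun t ht => ?_)
    fun t ht => fracPmf_eq_fracSeries hν0 k lam j (le_of_lt ht)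
  exact (hasDerivAt_fracSeries (geomBounded_pmfCoeff k lam j) hν0
    ht).differentiableAt.differentiableWithinAt
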